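/- All graphs are finite and simple. For a graph $G$, let $\alpha(G)$ denote the maximum size of a set of pairwise non-adjacent vertices. $G$ is $k$-connected if $|V(G)| > k$ and $G-S$ is connected for every $S \subseteq V(G)$ with $|S| < k$; $G$ is regular if all its vertices have the same degree; a Hamiltonian path of $G$ is a path in $G$ that contains all vertices of $G$. For each positive integer $k$ there exists an integer $n_0$ (depending only on $k$) such that every $k$-connected regular graph $G$ with $\alpha(G) \le k+2$ and at least $n_0$ vertices has a Hamiltonian path. -/

import Mathlib

namespace SimpleGraph

/-- A finite graph `G` is `k`-connected if it has more than `k` vertices and `G - S` is connected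
for every set `S` of fewer than `k` vertices. -/
def IsKConnected {V : Type*} [Fintype V] (G : SimpleGraph V) (k : ℕ) : Prop :=
  k < Fintype.card V ∧
    ∀ S : Finset V, S.card < k → (G.induce {v : V | v ∉ S}).Connected

/-- `G` is regular: all vertices have the same degree. -/
def IsRegularGraph {V : Type*} (G : SimpleGraph V) [G.LocallyFinite] : Prop :=
  ∃ d : ℕ, G.IsRegularOfDegree d

/-- `G` has a Hamiltonian path: some walk in `G` visits every vertex exactly once. -/
def HasHamiltonianPath {V : Type*} [DecidableEq V] (G : SimpleGraph V) : Prop :=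
  ∃ (u v : V) (p : G.Walk u v), p.IsHamiltonian

end SimpleGraph

/-!
Suppose that a longest path `P` misses a vertex, and let `H` be a component of `G - P` with boundary
`S`. By maximality of `P`, its first vertex and the successors on `P` of the vertices of `S` are
pairwise non-adjacent and have no neighbour in `H`. Hence `|S| + 1 + α(G[H]) ≤ α(G) ≤ k + 2`, while
`|S| ≥ k` by connectivity, so that `|S| = k` and `H` is a clique.

Connectivity also shows that two boundary vertices have at least two neighbours in `H` between them,
and so they are joined by a path through all of `H`. As such a detour cannot lengthen `P`, the
`k + 1` points where `P` can be left towards `H` start disjoint segments of `|H|` vertices without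
neighbours in `H`. There are thus at least `(k + 1)|H|` vertices outside `H ∪ S`.

Let `G` be `d`-regular with `d` large, as it is for large graphs because `α(G)` is bounded. Two
non-adjacent vertices with few neighbours outside `H ∪ S` would extend to an independent set of more
than `k + 2` vertices. Therefore a boundary vertex with a non-neighbour in `H` has almost all its
neighbours outside `H ∪ S`; since all vertices of `H` have equally many neighbours in `S`, no such
boundary vertex exists, and then `S` is a clique as well. So `H ∪ S` is a clique on `d + 1`
vertices, that is, a whole component of `G`, which is impossible in a connected graph.
-/

open SimpleGraph

namespace LongestPath

section IndependentSets

variable {V : Type*} {G : SimpleGraph V}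

theorem card_add_card_le_indepNum [Finite V] {I J : Finset V} (hI : G.IsIndepSet (I : Set V))
    (hJ : G.IsIndepSet (J : Set V)) (hdisj : Disjoint I J) (hIJ : ∀ a ∈ I, ∀ b ∈ J, ¬ G.Adj a b) :
    I.card + J.card ≤ G.indepNum := by
  classical
  rw [← Finset.card_union_of_disjoint hdisj]
  refine IsIndepSet.card_le_indepNum ?_
  rw [Finset.coe_union]
  exact Set.pairwise_union.2
    ⟨hI, hJ, fun a ha b hb _ => ⟨hIJ a ha b hb, fun h => hIJ a ha b hb h.symm⟩⟩

/-- A maximal independent subset `I` of `X` dominates `X`. -/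
theorem exists_isIndepSet_card_le_mul [G.LocallyFinite] {d : ℕ} (hdeg : ∀ v, G.degree v ≤ d)
    (X : Finset V) : ∃ I ⊆ X, G.IsIndepSet (I : Set V) ∧ X.card ≤ I.card * (d + 1) := by
  classical
  have hfin : {I : Finset V | I ⊆ X ∧ G.IsIndepSet (I : Set V)}.Finite :=
    X.powerset.finite_toSet.subset fun I hI => Finset.mem_powerset.2 hI.1
  obtain ⟨I, hI⟩ := hfin.exists_maximal ⟨∅, by simp [IsIndepSet]⟩
  obtain ⟨hIX, hIind⟩ := hI.prop
  have hdom : X ⊆ I.biUnion fun v => insert v (G.neighborFinset v) := by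
    intro x hx
    by_contra hxI
    simp only [Finset.mem_biUnion, Finset.mem_insert, mem_neighborFinset, not_exists, not_and,
      not_or] at hxI
    have hins : G.IsIndepSet ((insert x I : Finset V) : Set V) := by
      rw [Finset.coe_insert]
      exact hIind.insert fun v hv _ => ⟨fun h => (hxI v hv).2 h.symm, (hxI v hv).2⟩
    have hxI' : x ∈ I := hI.le_of_ge ⟨Finset.insert_subset hx hIX, hins⟩
      (Finset.subset_insert x I) (Finset.mem_insert_self x I)
    exact (hxI x hxI').1 rfl
  refine ⟨I, hIX, hIind, (Finset.card_le_card hdom).trans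
    (Finset.card_biUnion_le_card_mul _ _ _ fun v _ => ?_)⟩
  exact (Finset.card_insert_le _ _).trans (by simpa using hdeg v)

end IndependentSets

section Neighborhoods

variable {V : Type*} [Fintype V] [DecidableEq V] {G : SimpleGraph V} [DecidableRel G.Adj]
  {H : Finset V} {k d : ℕ}

/-- The vertex boundary `N(H)` of a vertex set `H`: the vertices outside `H` that have a neighbour
in `H`. It is what separates `H` from the rest of the graph. -/
def outerBoundary (G : SimpleGraph V) [DecidableRel G.Adj] (H : Finset V) : Finset V :=
  {s | s ∉ H ∧ ∃ v ∈ H, G.Adj s v}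

/-- The vertices that are neither in `H` nor adjacent to a vertex of `H`. -/
def exterior (G : SimpleGraph V) [DecidableRel G.Adj] (H : Finset V) : Finset V :=
  (H ∪ outerBoundary G H)ᶜ

theorem mem_outerBoundary {s : V} :
    s ∈ outerBoundary G H ↔ s ∉ H ∧ ∃ v ∈ H, G.Adj s v := by
  simp [outerBoundary]

theorem mem_exterior {w : V} : w ∈ exterior G H ↔ w ∉ H ∧ ∀ v ∈ H, ¬ G.Adj w v := by
  simp only [exterior, Finset.mem_compl, Finset.mem_union, mem_outerBoundary, not_or, not_and,
    not_exists]
  exact ⟨fun h => ⟨h.1, h.2 h.1⟩, fun h => ⟨h.1, fun _ => h.2⟩⟩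

theorem disjoint_outerBoundary : Disjoint H (outerBoundary G H) :=
  Finset.disjoint_right.2 fun _ hs => (mem_outerBoundary.1 hs).1

theorem disjoint_exterior : Disjoint (H ∪ outerBoundary G H) (exterior G H) :=
  disjoint_compl_right

theorem card_inter_add_card_inter_outerBoundary_add_card_inter_exterior (A : Finset V) :
    (A ∩ H).card + (A ∩ outerBoundary G H).card + (A ∩ exterior G H).card = A.card := by
  rw [← Finset.card_union_of_disjoint
      (disjoint_outerBoundary.mono Finset.inter_subset_right Finset.inter_subset_right),
    ← Finset.inter_union_distrib_left, exterior, ← Finset.sdiff_eq_inter_compl,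
    Finset.card_inter_add_card_sdiff]

theorem neighborFinset_inter_exterior {v : V} (hv : v ∈ H) :
    G.neighborFinset v ∩ exterior G H = ∅ := by
  ext w
  simp only [Finset.mem_inter, mem_neighborFinset, mem_exterior, Finset.notMem_empty, iff_false]
  exact fun h => h.2.2 v hv h.1.symm

theorem le_card_outerBoundary (hG : G.IsKConnected k) (hH : H.Nonempty)
    (hext : (exterior G H).Nonempty) : k ≤ (outerBoundary G H).card := by
  by_contra! hlt
  obtain ⟨v, hv⟩ := hH
  obtain ⟨w, hw⟩ := hext
  have hvS : v ∉ outerBoundary G H := Finset.disjoint_left.1 disjoint_outerBoundary hv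
  have hwS : w ∉ outerBoundary G H := fun h =>
    Finset.disjoint_right.1 disjoint_exterior hw (Finset.mem_union_right _ h)
  obtain ⟨p⟩ := (hG.2 _ hlt).preconnected ⟨v, hvS⟩ ⟨w, hwS⟩
  obtain ⟨e, -, heH, he⟩ := p.exists_boundary_dart {x | (x : V) ∈ H} hv (mem_exterior.1 hw).1
  exact e.snd.2 (mem_outerBoundary.2 ⟨he, e.fst, heH, e.adj.symm⟩)

/-- The neighbours of `T` in `H`, together with the rest of the boundary, separate what remains of
`H` from the exterior. -/
theorem add_card_le_card_outerBoundary_add_card_neighbors (hG : G.IsKConnected k)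
    (hext : (exterior G H).Nonempty) {T : Finset V} (hT : T ⊆ outerBoundary G H)
    (hlt : (H.filter fun v => ∃ s ∈ T, G.Adj s v).card < H.card) :
    k + T.card ≤ (outerBoundary G H).card + (H.filter fun v => ∃ s ∈ T, G.Adj s v).card := by
  set U := H.filter fun v => ∃ s ∈ T, G.Adj s v
  have hsub : outerBoundary G (H \ U) ⊆ U ∪ (outerBoundary G H \ T) := by
    intro s hs
    obtain ⟨hsHU, v, hv, hsv⟩ := mem_outerBoundary.1 hs
    have ⟨hvH, hvU⟩ := Finset.mem_sdiff.1 hv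
    have hsT : s ∉ T := fun h => hvU (Finset.mem_filter.2 ⟨hvH, s, h, hsv⟩)
    by_cases hsH : s ∈ H
    · simp_all
    · exact Finset.mem_union_right _
        (Finset.mem_sdiff.2 ⟨mem_outerBoundary.2 ⟨hsH, v, hvH, hsv⟩, hsT⟩)
  have hne : (H \ U).Nonempty := Finset.sdiff_nonempty_of_card_lt_card hlt
  have hext' : (exterior G (H \ U)).Nonempty := hext.mono fun w hw => by
    rw [mem_exterior] at hw ⊢
    exact ⟨fun h => hw.1 (Finset.sdiff_subset h), fun v hv => hw.2 v (Finset.sdiff_subset hv)⟩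
  have hk := (le_card_outerBoundary hG hne hext').trans
    ((Finset.card_le_card hsub).trans (Finset.card_union_le _ _))
  have := Finset.card_sdiff_add_card_eq_card hT
  omega

theorem card_le_indepNum_sub_mul_add_sum (hdeg : ∀ v, G.degree v ≤ d) {J X : Finset V}
    (hJ : G.IsIndepSet (J : Set V)) (hJX : Disjoint J X) :
    X.card ≤ (G.indepNum - J.card) * (d + 1) + ∑ j ∈ J, (G.neighborFinset j ∩ X).card := by
  obtain ⟨I, hIX, hI, hcard⟩ :=
    exists_isIndepSet_card_le_mul hdeg (X \ J.biUnion fun j => G.neighborFinset j ∩ X)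
  have hIJ : I.card + J.card ≤ G.indepNum := by
    refine card_add_card_le_indepNum hI hJ
      (hJX.symm.mono_left (hIX.trans Finset.sdiff_subset)) fun a ha j hj haj => ?_
    have ⟨haX, haJ⟩ := Finset.mem_sdiff.1 (hIX ha)
    exact haJ (Finset.mem_biUnion.2
      ⟨j, hj, Finset.mem_inter.2 ⟨(mem_neighborFinset ..).2 haj.symm, haX⟩⟩)
  have hsdiff := Finset.le_card_sdiff (J.biUnion fun j => G.neighborFinset j ∩ X) X
  have hsum := Finset.card_biUnion_le (s := J) (t := fun j => G.neighborFinset j ∩ X)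
  have := Nat.mul_le_mul_right (d + 1) (Nat.le_sub_of_add_le hIJ)
  omega

theorem card_le_mul_add_of_not_adj (hdeg : ∀ v, G.degree v ≤ d) (hα : G.indepNum ≤ k + 2)
    {X : Finset V} {s t : V} (hst : s ≠ t) (hadj : ¬ G.Adj s t) (hs : s ∉ X) (ht : t ∉ X) :
    X.card ≤ k * (d + 1) + ((G.neighborFinset s ∩ X).card + (G.neighborFinset t ∩ X).card) := by
  have hJ : G.IsIndepSet (({s, t} : Finset V) : Set V) := by
    rw [Finset.coe_pair]
    exact Set.pairwise_pair.2 fun _ => ⟨hadj, fun h => hadj h.symm⟩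
  have h := card_le_indepNum_sub_mul_add_sum hdeg hJ (X := X)
    (Finset.disjoint_left.2 (by simp [hs, ht]))
  rw [Finset.card_pair hst, Finset.sum_pair hst] at h
  exact h.trans (Nat.add_le_add_right (Nat.mul_le_mul_right _ (by omega)) _)

theorem degree_add_one_eq_of_isClique (hH : G.IsClique (H : Set V)) {v : V} (hv : v ∈ H) :
    G.degree v + 1 = H.card + (G.neighborFinset v ∩ outerBoundary G H).card := by
  have hinter : G.neighborFinset v ∩ H = H.erase v := by
    ext w
    simp only [Finset.mem_inter, mem_neighborFinset, Finset.mem_erase]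
    exact ⟨fun h => ⟨h.1.ne', h.2⟩, fun h => ⟨hH hv h.2 h.1.symm, h.2⟩⟩
  have h := card_inter_add_card_inter_outerBoundary_add_card_inter_exterior (G := G) (H := H)
    (G.neighborFinset v)
  rw [hinter, neighborFinset_inter_exterior hv, card_neighborFinset_eq_degree,
    Finset.card_empty] at h
  have := Finset.card_erase_add_one hv
  omega

theorem degree_lt_card_add_of_isClique (hH : G.IsClique (H : Set V)) {v : V} (hv : v ∈ H) :
    G.degree v < H.card + (outerBoundary G H).card := by
  have := degree_add_one_eq_of_isClique hH hv
  have := Finset.card_le_card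
    (Finset.inter_subset_right (s₁ := G.neighborFinset v) (s₂ := outerBoundary G H))
  omega

theorem outerBoundary_eq_empty_of_isClique (hreg : G.IsRegularOfDegree d)
    (hH : G.IsClique (H : Set V)) (hcard : H.card = d + 1) : outerBoundary G H = ∅ := by
  refine Finset.eq_empty_of_forall_notMem fun s hs => ?_
  obtain ⟨-, v, hv, hsv⟩ := mem_outerBoundary.1 hs
  have h := degree_add_one_eq_of_isClique hH hv
  rw [hreg v] at h
  have hempty : G.neighborFinset v ∩ outerBoundary G H = ∅ := Finset.card_eq_zero.1 (by omega)
  exact Finset.notMem_empty s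
    (hempty ▸ Finset.mem_inter.2 ⟨(mem_neighborFinset ..).2 hsv.symm, hs⟩)

/-- The boundary vertices with a non-neighbour in `H` have so few neighbours in `H` that some
`v₀ ∈ H` is adjacent to none of them. Every vertex of `H` sees the other, complete, boundary
vertices, and all vertices of `H` have equally many neighbours in the boundary, so no vertex of `H`
sees an incomplete one. -/
theorem adj_of_forall_card_neighborFinset_inter_le (hreg : G.IsRegularOfDegree d)
    (hH : G.IsClique (H : Set V)) {m : ℕ}
    (hfew : ∀ s ∈ outerBoundary G H, ∀ v ∈ H, ¬ G.Adj s v → (G.neighborFinset s ∩ H).card ≤ m)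
    (hm : (outerBoundary G H).card * m < H.card) :
    ∀ s ∈ outerBoundary G H, ∀ v ∈ H, G.Adj s v := by
  set B := (outerBoundary G H).filter fun s => ∃ v ∈ H, ¬ G.Adj s v
  obtain ⟨v₀, hv₀, hv₀B⟩ : ∃ v₀ ∈ H, ∀ s ∈ B, ¬ G.Adj s v₀ := by
    by_contra! hcover
    have hsub : H ⊆ B.biUnion fun s => G.neighborFinset s ∩ H := fun v hv => by
      obtain ⟨s, hs, hsv⟩ := hcover v hv
      exact Finset.mem_biUnion.2 ⟨s, hs, Finset.mem_inter.2 ⟨(mem_neighborFinset ..).2 hsv, hv⟩⟩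
    have hle := (Finset.card_le_card hsub).trans
      (Finset.card_biUnion_le_card_mul B _ m fun s hs => by
        obtain ⟨hsS, v, hv, hsv⟩ := Finset.mem_filter.1 hs
        exact hfew s hsS v hv hsv)
    have hB : B.card ≤ (outerBoundary G H).card := Finset.card_filter_le _ _
    exact (hle.trans (Nat.mul_le_mul_right m hB)).not_gt hm
  have hcomplete : ∀ s ∈ outerBoundary G H, G.Adj s v₀ → ∀ v ∈ H, G.Adj s v := by
    intro s hs hsv₀ v hv
    by_contra hsv
    exact hv₀B s (Finset.mem_filter.2 ⟨hs, v, hv, hsv⟩) hsv₀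
  have hsame : ∀ v ∈ H, G.neighborFinset v₀ ∩ outerBoundary G H =
      G.neighborFinset v ∩ outerBoundary G H := by
    intro v hv
    refine Finset.eq_of_subset_of_card_le (fun s hs => ?_) ?_
    · simp only [Finset.mem_inter, mem_neighborFinset] at hs ⊢
      exact ⟨(hcomplete s hs.2 hs.1.symm v hv).symm, hs.2⟩
    · have h₀ := degree_add_one_eq_of_isClique hH hv₀
      have h := degree_add_one_eq_of_isClique hH hv
      rw [hreg] at h₀ h
      omega
  intro s hs
  obtain ⟨-, u, hu, hsu⟩ := mem_outerBoundary.1 hs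
  have hmem : s ∈ G.neighborFinset v₀ ∩ outerBoundary G H :=
    hsame u hu ▸ Finset.mem_inter.2 ⟨(mem_neighborFinset ..).2 hsu.symm, hs⟩
  exact hcomplete s hs ((mem_neighborFinset ..).1 (Finset.mem_inter.1 hmem).1).symm

theorem card_neighborFinset_inter_le_of_not_adj (hdeg : ∀ v, G.degree v ≤ d)
    (hα : G.indepNum ≤ k + 2) (hW : (k + 1) * (d + 1) ≤ (exterior G H).card + k * (k + 1))
    {s v : V} (hs : s ∈ outerBoundary G H) (hv : v ∈ H) (hsv : ¬ G.Adj s v) :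
    (G.neighborFinset s ∩ H).card ≤ k * (k + 1) := by
  have hsH : s ∉ H := (mem_outerBoundary.1 hs).1
  have hle := card_le_mul_add_of_not_adj hdeg hα (X := exterior G H)
    (ne_of_mem_of_not_mem hv hsH).symm hsv
    (Finset.disjoint_left.1 disjoint_exterior (Finset.mem_union_right _ hs))
    (Finset.disjoint_left.1 disjoint_exterior (Finset.mem_union_left _ hv))
  rw [neighborFinset_inter_exterior hv, Finset.card_empty] at hle
  have hsum := card_inter_add_card_inter_outerBoundary_add_card_inter_exterior (G := G) (H := H)
    (G.neighborFinset s)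
  have := card_neighborFinset_eq_degree G s ▸ hdeg s
  rw [add_one_mul] at hW
  omega

theorem isClique_outerBoundary (hdeg : ∀ v, G.degree v ≤ d) (hα : G.indepNum ≤ k + 2)
    (hcomplete : ∀ s ∈ outerBoundary G H, ∀ v ∈ H, G.Adj s v)
    (hW : k * (d + 1) + 2 * (d - H.card) < (exterior G H).card) :
    G.IsClique (outerBoundary G H : Set V) := by
  have hfew : ∀ s ∈ outerBoundary G H,
      (G.neighborFinset s ∩ exterior G H).card ≤ d - H.card := by
    intro s hs
    have hinter : G.neighborFinset s ∩ H = H := Finset.inter_eq_right.2 fun v hv =>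
      (mem_neighborFinset ..).2 (hcomplete s hs v hv)
    have hsum := card_inter_add_card_inter_outerBoundary_add_card_inter_exterior (G := G) (H := H)
      (G.neighborFinset s)
    rw [hinter] at hsum
    have := card_neighborFinset_eq_degree G s ▸ hdeg s
    omega
  intro s hs t ht hst
  by_contra hadj
  have hle := card_le_mul_add_of_not_adj hdeg hα (X := exterior G H) hst hadj
    (Finset.disjoint_left.1 disjoint_exterior (Finset.mem_union_right _ hs))
    (Finset.disjoint_left.1 disjoint_exterior (Finset.mem_union_right _ ht))
  have := hfew s hs
  have := hfew t ht
  omega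

theorem isClique_union_outerBoundary (hH : G.IsClique (H : Set V))
    (hS : G.IsClique (outerBoundary G H : Set V))
    (hcomplete : ∀ s ∈ outerBoundary G H, ∀ v ∈ H, G.Adj s v) :
    G.IsClique ((H ∪ outerBoundary G H : Finset V) : Set V) := by
  rw [Finset.coe_union]
  exact Set.pairwise_union.2
    ⟨hH, hS, fun v hv s hs _ => ⟨(hcomplete s hs v hv).symm, hcomplete s hs v hv⟩⟩

theorem card_exterior_lt_of_isClique (hk : 1 ≤ k) (hG : G.IsKConnected k)
    (hreg : G.IsRegularOfDegree d) (hα : G.indepNum ≤ k + 2) (hd : (k + 2) ^ 3 ≤ d)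
    (hH : G.IsClique (H : Set V)) (hne : H.Nonempty) (hS : (outerBoundary G H).card = k) :
    (exterior G H).card < (k + 1) * H.card := by
  by_contra! hWH
  obtain ⟨v, hv⟩ := hne
  have hdH : d + 1 ≤ H.card + k := by
    rw [← hreg v, ← hS]
    exact degree_lt_card_add_of_isClique hH hv
  have hdeg : ∀ v, G.degree v ≤ d := fun v => (hreg v).le
  have hW : (k + 1) * (d + 1) ≤ (exterior G H).card + k * (k + 1) := by nlinarith
  have hcomplete : ∀ s ∈ outerBoundary G H, ∀ v ∈ H, G.Adj s v :=
    adj_of_forall_card_neighborFinset_inter_le hreg hH (m := k * (k + 1))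
      (fun s hs v hv => card_neighborFinset_inter_le_of_not_adj hdeg hα hW hs hv)
      (by rw [hS]; nlinarith)
  have hSclique : G.IsClique (outerBoundary G H : Set V) :=
    isClique_outerBoundary hdeg hα hcomplete (by
      have : d - H.card ≤ k := by omega
      nlinarith)
  have hcard : (H ∪ outerBoundary G H).card = d + 1 := by
    have hinter : G.neighborFinset v ∩ outerBoundary G H = outerBoundary G H :=
      Finset.inter_eq_right.2 fun s hs => (mem_neighborFinset ..).2 (hcomplete s hs v hv).symm
    rw [Finset.card_union_of_disjoint disjoint_outerBoundary, ← hreg v,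
      degree_add_one_eq_of_isClique hH hv, hinter]
  have hempty := outerBoundary_eq_empty_of_isClique hreg
    (isClique_union_outerBoundary hH hSclique hcomplete) hcard
  have hext : (exterior G (H ∪ outerBoundary G H)).Nonempty := by
    rw [exterior, hempty, Finset.union_empty]
    exact Finset.card_pos.1 ((Nat.mul_pos k.succ_pos (Finset.card_pos.2 ⟨v, hv⟩)).trans_le hWH)
  have := le_card_outerBoundary hG ⟨v, Finset.mem_union_left _ hv⟩ hext
  rw [hempty, Finset.card_empty] at this
  omega

end Neighborhoods

section Paths

variable {V : Type*} {G : SimpleGraph V} {P l l₁ l₂ q : List V} {H : Finset V} {a b : Option V}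
  {i j : ℕ}

/-- A path of `G`, given by the list of its vertices. In contrast to `SimpleGraph.Walk` there is no
dependence on the endpoints, so that paths can be cut and glued freely. -/
structure IsPathList (G : SimpleGraph V) (l : List V) : Prop where
  isChain : l.IsChain G.Adj
  nodup : l.Nodup

/-- A path of `G` with the largest possible number of vertices. -/
structure IsLongestPathList (G : SimpleGraph V) (P : List V) : Prop extends IsPathList G P where
  length_le : ∀ l, IsPathList G l → l.length ≤ P.length

theorem exists_isLongestPathList [Finite V] (G : SimpleGraph V) :
    ∃ P, IsLongestPathList G P := by
  have := Fintype.ofFinite V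
  obtain ⟨P, hP, hmax⟩ := Set.exists_max_image {l | IsPathList G l} List.length
    ((List.finite_length_le V (Fintype.card V)).subset fun l hl => hl.nodup.length_le_card)
    ⟨[], by simp, by simp⟩
  exact ⟨P, hP, hmax⟩

namespace IsPathList

theorem hasHamiltonianPath [DecidableEq V] [Nonempty V] (hl : IsPathList G l)
    (hmem : ∀ v, v ∈ l) : G.HasHamiltonianPath := by
  have hne : l ≠ [] := List.ne_nil_of_mem (hmem (Classical.arbitrary V))
  refine ⟨_, _, Walk.ofSupport l hne hl.isChain, fun v => ?_⟩
  rw [Walk.support_ofSupport]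
  exact List.count_eq_one_of_mem hl.nodup (hmem v)

theorem take (hl : IsPathList G l) (n : ℕ) : IsPathList G (l.take n) :=
  ⟨hl.isChain.take n, hl.nodup.take⟩

theorem drop (hl : IsPathList G l) (n : ℕ) : IsPathList G (l.drop n) :=
  ⟨hl.isChain.drop n, hl.nodup.drop⟩

theorem reverse (hl : IsPathList G l) : IsPathList G l.reverse :=
  ⟨List.isChain_reverse.2 (hl.isChain.imp fun _ _ h => h.symm), List.nodup_reverse.2 hl.nodup⟩

theorem append (h₁ : IsPathList G l₁) (h₂ : IsPathList G l₂) (hdisj : l₁.Disjoint l₂)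
    (hadj : ∀ x ∈ l₁.getLast?, ∀ y ∈ l₂.head?, G.Adj x y) : IsPathList G (l₁ ++ l₂) :=
  ⟨h₁.isChain.append h₂.isChain hadj, h₁.nodup.append h₂.nodup hdisj⟩

end IsPathList

/-- The vertices of `H` at which a path can enter `H` from the vertex `c`. The value `c = none`
stands for a free end of the path, which may be put anywhere in `H`. -/
def entries (G : SimpleGraph V) [DecidableRel G.Adj] (H : Finset V) (c : Option V) : Finset V :=
  {v ∈ H | ∀ x ∈ c, G.Adj x v}

/-- A path inside `H` whose two ends can be attached to `a` and to `b`, respectively. -/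
structure IsLink (G : SimpleGraph V) [DecidableRel G.Adj] (H : Finset V) (a b : Option V)
    (q : List V) : Prop extends IsPathList G q where
  subset : ∀ v ∈ q, v ∈ H
  head?_mem : ∃ u ∈ entries G H a, q.head? = some u
  getLast?_mem : ∃ v ∈ entries G H b, q.getLast? = some v

variable [DecidableRel G.Adj]

theorem entries_none : entries G H none = H := by simp [entries]

theorem mem_entries_some {x v : V} : v ∈ entries G H (some x) ↔ v ∈ H ∧ G.Adj x v := by
  simp [entries]

theorem entries_some_nonempty_iff {s : V} :
    (entries G H (some s)).Nonempty ↔ ∃ v ∈ H, G.Adj s v := by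
  simp only [Finset.Nonempty, mem_entries_some]

namespace IsLink

theorem length_pos (hq : IsLink G H a b q) : 0 < q.length := by
  obtain ⟨u, -, hu⟩ := hq.head?_mem
  exact List.length_pos_of_mem (List.mem_of_head? hu)

theorem adj_head (hq : IsLink G H a b q) : ∀ x ∈ a, ∀ y ∈ q.head?, G.Adj x y := by
  obtain ⟨u, hu, hqu⟩ := hq.head?_mem
  intro x hx y hy
  obtain rfl : u = y := Option.some_injective _ (hqu.symm.trans hy)
  exact (Finset.mem_filter.1 hu).2 x hx

theorem adj_getLast (hq : IsLink G H a b q) : ∀ x ∈ q.getLast?, ∀ y ∈ b, G.Adj x y := by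
  obtain ⟨v, hv, hqv⟩ := hq.getLast?_mem
  intro x hx y hy
  obtain rfl : v = x := Option.some_injective _ (hqv.symm.trans hx)
  exact ((Finset.mem_filter.1 hv).2 y hy).symm

theorem append_left (hq : IsLink G H l.getLast? b q) (hl : IsPathList G l)
    (hHl : ∀ v ∈ H, v ∉ l) : IsPathList G (l ++ q) :=
  hl.append hq.toIsPathList (fun v hv hvq => hHl v (hq.subset v hvq) hv) hq.adj_head

theorem getLast?_append (hq : IsLink G H a b q) (l : List V) :
    (l ++ q).getLast? = q.getLast? :=
  List.getLast?_append_of_ne_nil l (List.ne_nil_of_length_pos hq.length_pos)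

end IsLink

theorem exists_isLink_of_connected (hH : (G.induce (H : Set V)).Connected)
    (ha : (entries G H a).Nonempty) (hb : (entries G H b).Nonempty) : ∃ q, IsLink G H a b q := by
  obtain ⟨u, hu⟩ := ha
  obtain ⟨v, hv⟩ := hb
  obtain ⟨p, hp⟩ := (hH.preconnected ⟨u, (Finset.mem_filter.1 hu).1⟩
    ⟨v, (Finset.mem_filter.1 hv).1⟩).exists_isPath
  refine ⟨p.support.map Subtype.val, ⟨?_, hp.support_nodup.map Subtype.val_injective⟩,
    fun x hx => ?_, ⟨u, hu, ?_⟩, ⟨v, hv, ?_⟩⟩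
  · exact (List.isChain_map _).2 p.isChain_adj_support
  · obtain ⟨y, -, rfl⟩ := List.mem_map.1 hx
    exact y.2
  · rw [List.head?_map, List.head?_eq_some_head p.support_ne_nil, p.head_support, Option.map_some]
  · rw [List.getLast?_map, List.getLast?_eq_some_getLast p.support_ne_nil, p.getLast_support,
      Option.map_some]

theorem exists_isLink_length_eq_card [DecidableEq V] (hH : G.IsClique (H : Set V))
    (ha : (entries G H a).Nonempty) (hb : (entries G H b).Nonempty)
    (hab : 1 < (entries G H a ∪ entries G H b).card) :
    ∃ q, IsLink G H a b q ∧ q.length = H.card := by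
  obtain ⟨u, hu, v, hv, huv⟩ : ∃ u ∈ entries G H a, ∃ v ∈ entries G H b, u ≠ v := by
    by_contra! heq
    obtain ⟨u, hu⟩ := ha
    obtain ⟨v, hv⟩ := hb
    have hsub : entries G H a ∪ entries G H b ⊆ {u} := by
      refine Finset.union_subset (fun x hx => ?_) (fun x hx => ?_) <;> rw [Finset.mem_singleton]
      · rw [heq x hx v hv, heq u hu v hv]
      · exact (heq u hu x hx).symm
    exact hab.not_ge (Finset.card_le_card hsub)
  have huH : u ∈ H := (Finset.mem_filter.1 hu).1
  have hvH : v ∈ H.erase u := Finset.mem_erase.2 ⟨huv.symm, (Finset.mem_filter.1 hv).1⟩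
  set q := u :: (((H.erase u).erase v).toList ++ [v]) with hq
  have hperm : q.Perm H.toList := by
    refine ((List.perm_append_comm.trans ?_).cons u).trans (Finset.toList_insert
      (Finset.notMem_erase u H)).symm |>.trans (by rw [Finset.insert_erase huH])
    exact (Finset.toList_insert (Finset.notMem_erase v _)).symm.trans
      (by rw [Finset.insert_erase hvH])
  have hmem : ∀ x ∈ q, x ∈ H := fun x hx => Finset.mem_toList.1 (hperm.subset hx)
  have hnodup : q.Nodup := hperm.nodup_iff.2 H.nodup_toList
  have hchain : q.IsChain G.Adj :=
    (hnodup.imp_of_mem fun hx hy hxy => hH (hmem _ hx) (hmem _ hy) hxy).isChain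
  refine ⟨q, ⟨⟨hchain, hnodup⟩, hmem, ⟨u, hu, rfl⟩, ⟨v, hv, ?_⟩⟩, ?_⟩
  · rw [hq, ← List.cons_append, List.getLast?_concat]
  · rw [hperm.length_eq, Finset.length_toList]

theorem IsPathList.splice (hP : IsPathList G P) (hHP : ∀ v ∈ H, v ∉ P) (hij : i ≤ j)
    (hq : IsLink G H (P.take i).getLast? P[j]? q) :
    IsPathList G (P.take i ++ q ++ P.drop j) := by
  refine (hq.append_left (hP.take i) fun v hv h => hHP v hv (List.mem_of_mem_take h)).append
    (hP.drop j) ?_ ?_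
  · refine List.disjoint_append_left.2 ⟨List.disjoint_take_drop hP.nodup hij, ?_⟩
    exact fun v hv h => hHP v (hq.subset v hv) (List.mem_of_mem_drop h)
  · rw [hq.getLast?_append, List.head?_drop]
    exact hq.adj_getLast

theorem IsPathList.splice_reverse (hP : IsPathList G P) (hHP : ∀ v ∈ H, v ∉ P) (hij : i < j)
    (hj : j < P.length) (hq : IsLink G H (P.take i).getLast? (P.take j).getLast? q)
    (hadj : G.Adj P[i] P[j]) :
    IsPathList G (P.take i ++ q ++ ((P.take j).drop i).reverse ++ P.drop j) := by
  have hnil : (P.take j).drop i ≠ [] := by simp; omega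
  have hsub : ((P.take j).drop i) ⊆ P := fun v hv => List.mem_of_mem_take (List.mem_of_mem_drop hv)
  have hleft := hq.append_left (hP.take i) fun v hv h => hHP v hv (List.mem_of_mem_take h)
  refine (hleft.append ((hP.take j).drop i).reverse ?_ ?_).append (hP.drop j) ?_ ?_
  · simp only [List.disjoint_append_left, List.disjoint_reverse_right]
    refine ⟨?_, fun v hv h => hHP v (hq.subset v hv) (hsub h)⟩
    have h := List.disjoint_take_drop (hP.take j).nodup (le_refl i)
    rwa [List.take_take, min_eq_left hij.le] at h
  · rw [hq.getLast?_append, List.head?_reverse, List.getLast?_drop, if_neg (by simp; omega)]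
    exact hq.adj_getLast
  · simp only [List.disjoint_append_left, List.disjoint_reverse_left]
    refine ⟨⟨List.disjoint_take_drop hP.nodup hij.le, ?_⟩, ?_⟩
    · exact fun v hv h => hHP v (hq.subset v hv) (List.mem_of_mem_drop h)
    · exact fun v hv h => List.disjoint_take_drop hP.nodup le_rfl (List.mem_of_mem_drop hv) h
  · rw [List.getLast?_append_of_ne_nil _ (by simpa using hnil), List.getLast?_reverse,
      List.head?_drop, List.getElem?_take_of_lt hij, List.head?_drop]
    simpa [hj, hij.trans hj] using hadj

namespace IsLongestPathList

theorem add_length_le (hP : IsLongestPathList G P) (hHP : ∀ v ∈ H, v ∉ P) (hij : i ≤ j)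
    (hj : j ≤ P.length) (hq : IsLink G H (P.take i).getLast? P[j]? q) : i + q.length ≤ j := by
  have h := hP.length_le _ (hP.splice hHP hij hq)
  simp only [List.length_append, List.length_take, List.length_drop] at h
  omega

/-- Otherwise `P` could be rerouted through the link, traversing its middle part backwards. -/
theorem not_adj (hP : IsLongestPathList G P) (hHP : ∀ v ∈ H, v ∉ P) (hij : i < j)
    (hj : j < P.length) (hq : IsLink G H (P.take i).getLast? (P.take j).getLast? q) :
    ¬ G.Adj P[i] P[j] := by
  intro hadj
  have h := hP.length_le _ (hP.splice_reverse hHP hij hj hq hadj)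
  have := hq.length_pos
  simp only [List.length_append, List.length_take, List.length_drop, List.length_reverse] at h
  omega

end IsLongestPathList

/-- The positions `t` of `P` such that a path can enter `H` right after the first `t` vertices of
`P`. -/
def departures (G : SimpleGraph V) [DecidableRel G.Adj] (P : List V) (H : Finset V) :
    Finset (Fin P.length) :=
  {t | (entries G H (P.take t).getLast?).Nonempty}

theorem mem_departures {t : Fin P.length} :
    t ∈ departures G P H ↔ (entries G H (P.take t).getLast?).Nonempty := by
  simp [departures]

/-- The vertices of `P` at the positions in `departures G P H`: the first vertex of `P` and the
successors on `P` of the boundary vertices of `H`. -/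
def successors [DecidableEq V] (G : SimpleGraph V) [DecidableRel G.Adj] (P : List V)
    (H : Finset V) : Finset V :=
  (departures G P H).image P.get

theorem card_successors [DecidableEq V] (hP : P.Nodup) :
    (successors G P H).card = (departures G P H).card :=
  Finset.card_image_of_injective _ (List.nodup_iff_injective_get.1 hP)

theorem disjoint_toFinset_take_drop [DecidableEq V] (hP : P.Nodup) {m : ℕ} (hij : i + m ≤ j) :
    Disjoint ((P.drop i).take m).toFinset ((P.drop j).take m).toFinset := by
  refine List.disjoint_toFinset_iff_disjoint.2 fun v hvi hvj => ?_
  rw [List.take_drop] at hvi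
  exact List.disjoint_take_drop hP hij (List.mem_of_mem_drop hvi) (List.mem_of_mem_take hvj)

end Paths

section LongestPaths

variable {V : Type*} [Fintype V] [DecidableEq V] {G : SimpleGraph V} [DecidableRel G.Adj]
  {P : List V} {H : Finset V} {k i j : ℕ}

/-- `H` is the vertex set of a connected component of `G - P`. -/
structure IsComponentAvoiding (G : SimpleGraph V) [DecidableRel G.Adj] (P : List V)
    (H : Finset V) : Prop where
  connected : (G.induce (H : Set V)).Connected
  notMem : ∀ v ∈ H, v ∉ P
  mem_of_mem_outerBoundary : ∀ s ∈ outerBoundary G H, s ∈ P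

theorem exists_isComponentAvoiding (G : SimpleGraph V) [DecidableRel G.Adj] {v₀ : V}
    (hv₀ : v₀ ∉ P) : ∃ H, IsComponentAvoiding G P H := by
  have hsingleton : (G.induce (({v₀} : Finset V) : Set V)).Connected := by
    rw [Finset.coe_singleton]
    exact { preconnected := .of_subsingleton, nonempty := ⟨v₀, rfl⟩ }
  obtain ⟨H, hH⟩ := Set.Finite.exists_maximal
    (Set.toFinite {H : Finset V | (G.induce (H : Set V)).Connected ∧ ∀ v ∈ H, v ∉ P})
    ⟨{v₀}, hsingleton, by simpa using hv₀⟩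
  obtain ⟨hconn, hHP⟩ := hH.prop
  refine ⟨H, hconn, hHP, fun s hs => ?_⟩
  obtain ⟨hsH, v, hv, hsv⟩ := mem_outerBoundary.1 hs
  by_contra hsP
  have hinsert : (G.induce ((insert s H : Finset V) : Set V)).Connected := by
    have hset : ((insert s H : Finset V) : Set V) = {s, v} ∪ (H : Set V) := by
      rw [Finset.coe_insert, Set.insert_union, Set.singleton_union,
        Set.insert_eq_of_mem (Finset.mem_coe.2 hv)]
    rw [hset]
    exact induce_union_connected (induce_pair_connected_of_adj hsv).preconnected
      hconn.preconnected ⟨v, by simp, hv⟩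
  exact hsH (hH.le_of_ge ⟨hinsert, by simpa using ⟨hsP, hHP⟩⟩ (Finset.subset_insert s H)
    (Finset.mem_insert_self s H))

theorem lt_of_entries_nonempty (hP : IsLongestPathList G P) (hH : IsComponentAvoiding G P H)
    (hij : i ≤ j) (hj : j ≤ P.length) (hi : (entries G H (P.take i).getLast?).Nonempty)
    (hj' : (entries G H P[j]?).Nonempty) : i < j := by
  obtain ⟨q, hq⟩ := exists_isLink_of_connected hH.connected hi hj'
  have := hP.add_length_le hH.notMem hij hj hq
  have := hq.length_pos
  omega

theorem successors_subset_exterior (hP : IsLongestPathList G P)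
    (hH : IsComponentAvoiding G P H) : successors G P H ⊆ exterior G H := by
  intro x hx
  obtain ⟨t, ht, rfl⟩ := Finset.mem_image.1 hx
  refine mem_exterior.2 ⟨fun h => hH.notMem _ h (List.get_mem P t), fun v hv hadj => ?_⟩
  refine (lt_of_entries_nonempty hP hH le_rfl t.2.le (mem_departures.1 ht) ?_).false
  rw [List.getElem?_eq_getElem t.2]
  exact entries_some_nonempty_iff.2 ⟨v, hv, hadj⟩

theorem isIndepSet_successors (hP : IsLongestPathList G P) (hH : IsComponentAvoiding G P H) :
    G.IsIndepSet (successors G P H : Set V) := by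
  have hlt : ∀ t ∈ departures G P H, ∀ t' ∈ departures G P H, t < t' →
      ¬ G.Adj (P.get t) (P.get t') := fun t ht t' ht' htt' => by
    obtain ⟨q, hq⟩ := exists_isLink_of_connected hH.connected (mem_departures.1 ht)
      (mem_departures.1 ht')
    exact hP.not_adj hH.notMem htt' t'.2 hq
  intro x hx y hy hxy
  obtain ⟨t, ht, rfl⟩ := Finset.mem_image.1 (Finset.mem_coe.1 hx)
  obtain ⟨t', ht', rfl⟩ := Finset.mem_image.1 (Finset.mem_coe.1 hy)
  rcases lt_trichotomy t t' with h | rfl | h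
  · exact hlt t ht t' ht' h
  · exact absurd rfl hxy
  · exact fun hadj => hlt t' ht' t ht h hadj.symm

theorem card_outerBoundary_lt_card_departures (hP : IsLongestPathList G P)
    (hH : IsComponentAvoiding G P H) :
    (outerBoundary G H).card < (departures G P H).card := by
  have hfree : (entries G H none).Nonempty := by
    obtain ⟨v, hv⟩ := hH.connected.nonempty
    exact ⟨v, by rwa [entries_none]⟩
  have hend : (entries G H P[P.length]?).Nonempty := by rwa [List.getElem?_length]
  have hpos : 0 < P.length :=
    lt_of_entries_nonempty hP hH (Nat.zero_le _) le_rfl (by simpa using hfree) hend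
  have hzero : ⟨0, hpos⟩ ∈ departures G P H := mem_departures.2 (by simpa using hfree)
  have hsub : outerBoundary G H ⊆
      ((departures G P H).erase ⟨0, hpos⟩).image
        fun t : Fin P.length => P[(t : ℕ) - 1]'(by omega) := by
    intro s hs
    obtain ⟨i, hi, rfl⟩ := List.mem_iff_getElem.1 (hH.mem_of_mem_outerBoundary s hs)
    have hdep : (entries G H (P.take (i + 1)).getLast?).Nonempty := by
      simpa [List.getLast?_take, hi] using
        entries_some_nonempty_iff.2 (mem_outerBoundary.1 hs).2
    have hi' : i + 1 < P.length := lt_of_entries_nonempty hP hH hi le_rfl hdep hend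
    exact Finset.mem_image.2 ⟨⟨i + 1, hi'⟩,
      Finset.mem_erase.2 ⟨by simp, mem_departures.2 hdep⟩, rfl⟩
  exact (Finset.card_le_card hsub).trans_lt
    (Finset.card_image_le.trans_lt (Finset.card_erase_lt_of_mem hzero))

theorem exterior_nonempty (hP : IsLongestPathList G P) (hH : IsComponentAvoiding G P H) :
    (exterior G H).Nonempty := by
  refine Finset.Nonempty.mono (successors_subset_exterior hP hH) (Finset.card_pos.1 ?_)
  rw [card_successors hP.nodup]
  exact (Nat.zero_le _).trans_lt (card_outerBoundary_lt_card_departures hP hH)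

theorem card_outerBoundary_add_card_lt_indepNum (hP : IsLongestPathList G P)
    (hH : IsComponentAvoiding G P H) {J : Finset V} (hJH : J ⊆ H)
    (hJ : G.IsIndepSet (J : Set V)) : (outerBoundary G H).card + J.card < G.indepNum := by
  have hext : ∀ w ∈ successors G P H, w ∉ H ∧ ∀ v ∈ H, ¬ G.Adj w v := fun w hw =>
    mem_exterior.1 (successors_subset_exterior hP hH hw)
  have hle := card_add_card_le_indepNum (isIndepSet_successors hP hH) hJ
    (Finset.disjoint_left.2 fun w hw hwJ => (hext w hw).1 (hJH hwJ))
    fun w hw v hv => (hext w hw).2 v (hJH hv)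
  have := card_outerBoundary_lt_card_departures hP hH
  rw [card_successors hP.nodup] at hle
  omega

theorem card_outerBoundary_eq (hP : IsLongestPathList G P) (hH : IsComponentAvoiding G P H)
    (hG : G.IsKConnected k) (hα : G.indepNum ≤ k + 2) : (outerBoundary G H).card = k := by
  obtain ⟨v, hv⟩ := hH.connected.nonempty
  have hle := card_outerBoundary_add_card_lt_indepNum hP hH (J := {v}) (by simpa using hv)
    (by simp [IsIndepSet])
  have := le_card_outerBoundary hG ⟨v, hv⟩ (exterior_nonempty hP hH)
  rw [Finset.card_singleton] at hle
  omega

theorem isClique_of_indepNum_le (hP : IsLongestPathList G P) (hH : IsComponentAvoiding G P H)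
    (hG : G.IsKConnected k) (hα : G.indepNum ≤ k + 2) : G.IsClique (H : Set V) := by
  intro u hu v hv huv
  by_contra hadj
  have hJ : G.IsIndepSet (({u, v} : Finset V) : Set V) := by
    rw [Finset.coe_pair]
    exact Set.pairwise_pair.2 fun _ => ⟨hadj, fun h => hadj h.symm⟩
  have hle := card_outerBoundary_add_card_lt_indepNum hP hH
    (Finset.insert_subset hu (Finset.singleton_subset_iff.2 hv)) hJ
  rw [card_outerBoundary_eq hP hH hG hα, Finset.card_pair huv] at hle
  omega

theorem one_lt_card_entries_union_of_ne (hG : G.IsKConnected k) (hext : (exterior G H).Nonempty)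
    (hS : (outerBoundary G H).card ≤ k) (hH : 1 < H.card) {a b : Option V}
    (ha : ∀ x ∈ a, x ∈ outerBoundary G H) (hb : ∀ x ∈ b, x ∈ outerBoundary G H)
    (hab : ∀ x ∈ a, ∀ y ∈ b, x ≠ y) : 1 < (entries G H a ∪ entries G H b).card := by
  rcases a with _ | s
  · rw [entries_none]
    exact hH.trans_le (Finset.card_le_card Finset.subset_union_left)
  rcases b with _ | t
  · rw [entries_none]
    exact hH.trans_le (Finset.card_le_card Finset.subset_union_right)
  have hT : {s, t} ⊆ outerBoundary G H :=
    Finset.insert_subset (ha s rfl) (Finset.singleton_subset_iff.2 (hb t rfl))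
  have hunion : entries G H (some s) ∪ entries G H (some t) =
      H.filter fun v => ∃ x ∈ ({s, t} : Finset V), G.Adj x v := by
    ext v
    simp only [Finset.mem_union, mem_entries_some, Finset.mem_filter, Finset.mem_insert,
      Finset.mem_singleton, exists_eq_or_imp, exists_eq_left, and_or_left]
  rw [hunion]
  by_contra! hle
  have := add_card_le_card_outerBoundary_add_card_neighbors hG hext hT (hle.trans_lt hH)
  rw [Finset.card_pair (hab s rfl t rfl)] at this
  omega

theorem add_card_le_of_entries_nonempty (hP : IsLongestPathList G P)
    (hH : IsComponentAvoiding G P H) (hG : G.IsKConnected k)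
    (hclique : G.IsClique (H : Set V)) (hS : (outerBoundary G H).card ≤ k) (hcard : 1 < H.card)
    (hij : i ≤ j) (hj : j ≤ P.length) (hi : (entries G H (P.take i).getLast?).Nonempty)
    (hj' : (entries G H P[j]?).Nonempty) : i + H.card ≤ j := by
  have hboundary : ∀ c : Option V, (∀ x ∈ c, x ∈ P) → (entries G H c).Nonempty →
      ∀ x ∈ c, x ∈ outerBoundary G H := by
    rintro c hcP hc x rfl
    exact mem_outerBoundary.2
      ⟨fun h => hH.notMem x h (hcP x rfl), entries_some_nonempty_iff.1 hc⟩
  have hne : ∀ x ∈ (P.take i).getLast?, ∀ y ∈ P[j]?, x ≠ y := by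
    rintro x hx y hy rfl
    rw [← List.head?_drop] at hy
    exact List.disjoint_take_drop hP.nodup hij (List.mem_of_getLast? hx) (List.mem_of_head? hy)
  obtain ⟨q, hq, hlen⟩ := exists_isLink_length_eq_card hclique hi hj'
    (one_lt_card_entries_union_of_ne hG (exterior_nonempty hP hH) hS hcard
      (hboundary _ (fun x hx => List.mem_of_mem_take (List.mem_of_getLast? hx)) hi)
      (hboundary _ (fun x hx => List.mem_of_getElem? hx) hj') hne)
  exact hlen ▸ hP.add_length_le hH.notMem hij hj hq

theorem toFinset_take_drop_subset_exterior (hHP : ∀ v ∈ H, v ∉ P) {m : ℕ}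
    (hgap : ∀ j, i ≤ j → j ≤ P.length → (entries G H P[j]?).Nonempty → i + m ≤ j) :
    ((P.drop i).take m).toFinset ⊆ exterior G H := by
  intro x hx
  obtain ⟨j, hj, rfl⟩ := List.mem_take_iff_getElem.1 (List.mem_toFinset.1 hx)
  obtain ⟨hjm, hjP⟩ : j < m ∧ i + j < P.length := by
    simp only [List.length_drop] at hj
    omega
  rw [List.getElem_drop, mem_exterior]
  refine ⟨fun h => hHP _ h (List.getElem_mem hjP), fun v hv hadj => ?_⟩
  have := hgap (i + j) (Nat.le_add_right i j) hjP.le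
    (by rw [List.getElem?_eq_getElem hjP]; exact entries_some_nonempty_iff.2 ⟨v, hv, hadj⟩)
  omega

/-- The segments of `m` vertices that start at the positions in `departures G P H` are disjoint and
contain no boundary vertices. -/
theorem card_departures_mul_le_card_exterior (hP : P.Nodup) (hHP : ∀ v ∈ H, v ∉ P)
    (hne : H.Nonempty) {m : ℕ} (hgap : ∀ t ∈ departures G P H, ∀ j : ℕ, t ≤ j → j ≤ P.length →
      (entries G H P[j]?).Nonempty → t + m ≤ j) :
    (departures G P H).card * m ≤ (exterior G H).card := by
  have hspaced : ∀ t ∈ departures G P H, ∀ t' ∈ departures G P H, t < t' →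
      (t : ℕ) + m ≤ t' := fun t ht t' ht' htt' => by
    have hpred : (P.take t').getLast? = P[(t' : ℕ) - 1]? := by
      rw [List.getLast?_take, if_neg (by omega), List.getElem?_eq_getElem (by omega),
        Option.some_or]
    have := hgap t ht (t' - 1) (by omega) (by omega) (hpred ▸ mem_departures.1 ht')
    omega
  have hdisj : (departures G P H : Set (Fin P.length)).PairwiseDisjoint
      fun t => ((P.drop t).take m).toFinset := fun t ht t' ht' hne => by
    rcases hne.lt_or_gt with h | h
    · exact disjoint_toFinset_take_drop hP (hspaced t ht t' ht' h)
    · exact (disjoint_toFinset_take_drop hP (hspaced t' ht' t ht h)).symm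
  have hlength : ∀ t ∈ departures G P H, ((P.drop t).take m).toFinset.card = m := fun t ht => by
    have := hgap t ht P.length t.2.le le_rfl (by rwa [List.getElem?_length, entries_none])
    rw [List.toFinset_card_of_nodup hP.drop.take, List.length_take, List.length_drop]
    omega
  rw [← Finset.sum_const_nat hlength, ← Finset.card_biUnion hdisj]
  exact Finset.card_le_card
    (Finset.biUnion_subset.2 fun t ht => toFinset_take_drop_subset_exterior hHP (hgap t ht))

end LongestPaths

theorem IsLongestPathList.mem {V : Type*} [Fintype V] {G : SimpleGraph V} [DecidableRel G.Adj]
    {P : List V} {k d : ℕ} (hP : IsLongestPathList G P) (hk : 1 ≤ k) (hG : G.IsKConnected k)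
    (hreg : G.IsRegularOfDegree d) (hα : G.indepNum ≤ k + 2) (hd : (k + 2) ^ 3 ≤ d) (v : V) :
    v ∈ P := by
  classical
  by_contra hv
  obtain ⟨H, hH⟩ := exists_isComponentAvoiding G hv
  have hclique := isClique_of_indepNum_le hP hH hG hα
  have hS := card_outerBoundary_eq hP hH hG hα
  obtain ⟨u, hu⟩ := hH.connected.nonempty
  have hcard : 1 < H.card := by
    have hdeg := degree_lt_card_add_of_isClique hclique hu
    rw [hreg u, hS] at hdeg
    have : k + 2 ≤ (k + 2) ^ 3 := Nat.le_self_pow (by norm_num) _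
    omega
  have hsegments := card_departures_mul_le_card_exterior hP.nodup hH.notMem ⟨u, hu⟩
    fun t ht j htj hj hj' => add_card_le_of_entries_nonempty hP hH hG hclique hS.le hcard htj hj
      (mem_departures.1 ht) hj'
  have hmany : k + 1 ≤ (departures G P H).card :=
    hS ▸ card_outerBoundary_lt_card_departures hP hH
  exact (((Nat.mul_le_mul_right _ hmany).trans hsegments).trans_lt
    (card_exterior_lt_of_isClique hk hG hreg hα hd hclique ⟨u, hu⟩ hS)).false

end LongestPath

theorem mainTheorem8 (k : ℕ) (hk : 1 ≤ k) :
    ∃ n₀ : ℕ, ∀ (V : Type*) [Fintype V] [DecidableEq V]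
      (G : SimpleGraph V) [DecidableRel G.Adj],
      G.IsKConnected k → G.IsRegularGraph → G.indepNum ≤ k + 2 → n₀ ≤ Fintype.card V →
        G.HasHamiltonianPath := by
  refine ⟨(k + 2) * (k + 2) ^ 3 + 1, fun V _ _ G _ hG ⟨d, hreg⟩ hα hn => ?_⟩
  have : Nonempty V := Fintype.card_pos_iff.1 (by omega)
  have hd : (k + 2) ^ 3 ≤ d := by
    by_contra! hlt
    obtain ⟨I, -, hI, hcard⟩ :=
      LongestPath.exists_isIndepSet_card_le_mul (fun v => (hreg v).le) Finset.univ
    have hsmall : I.card * (d + 1) ≤ (k + 2) * (k + 2) ^ 3 :=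
      Nat.mul_le_mul (hI.card_le_indepNum.trans hα) hlt
    rw [Finset.card_univ] at hcard
    omega
  obtain ⟨P, hP⟩ := LongestPath.exists_isLongestPathList G
  exact hP.hasHamiltonianPath (hP.mem hk hG hreg hα hd)
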